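/- Let $k$ be an algebraically closed field, $A$ a finite-dimensional $k$-algebra and $B\subseteq A$ a unital subalgebra. Let $Q_A$ be a connected quiver with finite vertex set and $Q_B$ a subquiver of $Q_A$ with the same vertices, and let $\nu=(\nu_A,\nu_B)$ be a presentation of $A$ relative to $B$: surjective $k$-algebra maps $\nu_A:kQ_A\to A$ and $\nu_B:kQ_B\to B$, each injective on the set of vertices, such that $\nu_A|_{kQ_B}=\nu_B$. Assume that $\nu_A$ maps every vertex to a primitive idempotent and no arrow to $0$ (this holds, for instance, if $A$ is basic and $Q_A$ is its Gabriel quiver); the ideal $I_A=\ker\nu_A$ need not be admissible. A walk is a path in the quiver obtained from $Q_A$ by adding formal inverses of all arrows; paths are composed from right to left. A relation $r\in I_A$ is minimal if no proper non-empty subsum of $r$ (as a linear combination of paths) lies in $I_A$. Homotopy of walks is the equivalence relation, compatible with composition, that is generated by $\alpha^{-1}\alpha\sim s(\alpha)$ and $\alpha\alpha^{-1}\sim t(\alpha)$ for every arrow $\alpha$, and by $u\sim v$ whenever the paths $u,v$ both appear with non-zero coefficient in a minimal relation. For a vertex $*$ let $\pi_1(Q_A,I_A)=\pi_1(Q_A,I_A,*)$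 be the group of homotopy classes of closed walks at $*$, and let $N_B$ be its (normal) subgroup generated by the classes $[v^{-1}(u')^{-1}uv]$, where $u,u'$ are parallel walks in $Q_B$ and $v$ is a walk in $Q_A$ from $*$ to the source of $u$. Let $\mathrm{HH}^1(A)=\mathrm{Der}_k(A)/\mathrm{Inn}_k(A)$ and $\mathrm{HH}^1(A|B)=\mathrm{Der}_{B^e}(A)/\mathrm{Inn}_{B^e}(A)$, where the index $B^e$ means that only (inner) derivations that are homomorphisms of $B$-bimodules are taken. Let $\iota:\mathrm{Hom}(\pi_1(Q_A,I_A)/N_B,k)\to\mathrm{Hom}(\pi_1(Q_A,I_A),k)$ and $\iota_{\mathrm{HH}}:\mathrm{HH}^1(A|B)\to\mathrm{HH}^1(A)$ be the canonical maps. A parade data $\gamma$ is a choice of a walk $\gamma_x$ from $*$ to $x$ for every vertex $x$. It is a relative parade data if there are a vertex $x_i$ in each connected component $\Gamma_i$ of $Q_B$ and a walk $\gamma_{*,x_i}$ in $Q_A$ from $*$ to $x_i$ such that for every vertex $y$ of $\Gamma_i$ the walk $\gamma_y$ is $\gamma_{*,x_i}$ followed by a walk in $Q_B$ from $x_i$ to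 $y$. For a path $p$ put $\mathrm{cl}_\gamma(p)=[\gamma_{t(p)}^{-1}\,p\,\gamma_{s(p)}]$, and for $f\in\mathrm{Hom}(\pi_1(Q_A,I_A),k)$ let $\theta_{\nu,\gamma}(f)$ be the derivation of $A$ with $\nu_A(p)\mapsto f(\mathrm{cl}_\gamma(p))\,\nu_A(p)$ for all paths $p$. Then the class $\theta_\nu(f)$ of $\theta_{\nu,\gamma}(f)$ in $\mathrm{HH}^1(A)$ does not depend on the parade data $\gamma$, relative parade data exist, and there is an injective linear map $$\theta_\nu^{(A|B)}:\mathrm{Hom}(\pi_1(Q_A,I_A)/N_B,k)\to\mathrm{HH}^1(A|B)$$ such that for every relative parade data $\gamma$ and every $f$ the derivation $\theta_{\nu,\gamma}(\iota f)$ lies in $\mathrm{Der}_{B^e}(A)$ and has class $\theta_\nu^{(A|B)}(f)$ in $\mathrm{HH}^1(A|B)$. Moreover, the square $$\begin{array}{ccc}\mathrm{Hom}(\pi_1(Q_A,I_A),k)&\xrightarrow{\ \theta_\nu\ }&\mathrm{HH}^1(A)\\ {\scriptstyle\iota}\uparrow&&\uparrow{\scriptstyle\iota_{\mathrm{HH}}}\\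 \mathrm{Hom}(\pi_1(Q_A,I_A)/N_B,k)&\xrightarrow{\ \theta_\nu^{(A|B)}\ }&\mathrm{HH}^1(A|B)\end{array}$$ is a pullback square of $k$-vector spaces. -/

import Mathlib

open Quiver

noncomputable section

namespace RelHH

universe u v w

/-! ### The path algebra of a quiver -/

/-- A path of a quiver together with its source and its target. -/
structure TotalPath (V : Type u) [Quiver.{v} V] where
  src : V
  tgt : V
  path : Path src tgt

/-- The path algebra `kQ`: formal linear combinations of paths. -/
def PathAlgebra (k : Type w) [Field k] (V : Type u) [Quiver.{v} V] := TotalPath V →₀ k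

namespace PathAlgebra

variable {k : Type w} [Field k] {V : Type u} [Quiver.{v} V]

instance : AddCommGroup (PathAlgebra k V) := inferInstanceAs (AddCommGroup (TotalPath V →₀ k))
instance : Module k (PathAlgebra k V) := inferInstanceAs (Module k (TotalPath V →₀ k))

variable (k) in
/-- The basis element of the path algebra given by a path. -/
def ofPath {x y : V} (p : Path x y) : PathAlgebra k V := Finsupp.single ⟨x, y, p⟩ 1

/-- Linear extension of a map that is given on paths. -/
def lin {M : Type*} [AddCommGroup M] [Module k M] (φ : TotalPath V → M) :
    PathAlgebra k V →ₗ[k] M := Finsupp.linearCombination k φ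

theorem lin_ofPath {M : Type*} [AddCommGroup M] [Module k M] (φ : TotalPath V → M)
    {x y : V} (p : Path x y) : lin φ (ofPath k p) = φ ⟨x, y, p⟩ := by
  exact (Finsupp.linearCombination_single k 1 _).trans (one_smul k _)

theorem hom_ext {M : Type*} [AddCommGroup M] [Module k M] {φ ψ : PathAlgebra k V →ₗ[k] M}
    (h : ∀ {x y : V} (p : Path x y), φ (ofPath k p) = ψ (ofPath k p)) : φ = ψ :=
  Finsupp.lhom_ext' fun p => LinearMap.ext_ring (h p.path)

open Classical in
variable (k) in
/-- The product `p q` of two paths (first `q`, then `p`), which is `0` unless `q` ends where `p`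
starts. -/
def mulPath (p q : TotalPath V) : PathAlgebra k V :=
  if h : q.tgt = p.src then ofPath k (q.path.comp (p.path.cast h.symm rfl)) else 0

/-- The multiplication of the path algebra as a bilinear map. -/
def mulL : PathAlgebra k V →ₗ[k] PathAlgebra k V →ₗ[k] PathAlgebra k V :=
  lin fun p => lin fun q => mulPath k p q

instance : Mul (PathAlgebra k V) := ⟨fun r s => mulL r s⟩

theorem mul_def (r s : PathAlgebra k V) : r * s = mulL r s := rfl

theorem ofPath_mul_ofPath {x y z : V} (p : Path y z) (q : Path x y) :
    ofPath k p * ofPath k q = ofPath k (q.comp p) := by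
  simp [mul_def, mulL, lin_ofPath, mulPath]

theorem ofPath_mul_ofPath_of_ne {x y y' z : V} (p : Path y' z) (q : Path x y) (h : y ≠ y') :
    ofPath k p * ofPath k q = 0 := by
  simp [mul_def, mulL, lin_ofPath, mulPath, h]

instance [Fintype V] : One (PathAlgebra k V) := ⟨∑ x : V, ofPath k (Path.nil : Path x x)⟩

theorem one_def [Fintype V] :
    (1 : PathAlgebra k V) = ∑ x : V, ofPath k (Path.nil : Path x x) := rfl

theorem one_mul_aux [Fintype V] (r : PathAlgebra k V) : 1 * r = r := by
  suffices h : mulL (1 : PathAlgebra k V) = LinearMap.id from LinearMap.congr_fun h r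
  refine hom_ext fun {x y} p => ?_
  rw [one_def, map_sum, LinearMap.sum_apply, Finset.sum_eq_single y]
  · exact ofPath_mul_ofPath _ _
  · exact fun z _ hz => ofPath_mul_ofPath_of_ne _ _ hz.symm
  · simp

theorem mul_one_aux [Fintype V] (r : PathAlgebra k V) : r * 1 = r := by
  suffices h : mulL.flip (1 : PathAlgebra k V) = LinearMap.id from LinearMap.congr_fun h r
  refine hom_ext fun {x y} p => ?_
  rw [one_def, map_sum, LinearMap.sum_apply, Finset.sum_eq_single x]
  · exact (ofPath_mul_ofPath p Path.nil).trans (by simp)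
  · exact fun z _ hz => ofPath_mul_ofPath_of_ne p Path.nil hz
  · simp

theorem induction {P : PathAlgebra k V → Prop} (h0 : P 0) (hadd : ∀ r s, P r → P s → P (r + s))
    (hpath : ∀ (c : k) {x y : V} (p : Path x y), P (c • ofPath k p)) (r : PathAlgebra k V) :
    P r := by
  refine Finsupp.induction_linear r h0 (fun r s => hadd r s) fun p c => ?_
  have := hpath c p.path
  have e : c • ofPath k p.path = (Finsupp.single p c : TotalPath V →₀ k) :=
    (Finsupp.smul_single c p (1 : k)).trans (by simp)
  rwa [e] at this

theorem mul_assoc_aux (r s t : PathAlgebra k V) : r * s * t = r * (s * t) := by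
  simp only [mul_def]
  induction r using induction with
  | h0 => simp
  | hadd a b ha hb => simp only [map_add, LinearMap.add_apply, ha, hb]
  | hpath c p =>
  induction s using induction with
  | h0 => simp
  | hadd a b ha hb => simp only [map_add, LinearMap.add_apply, ha, hb]
  | hpath d q =>
  induction t using induction with
  | h0 => simp
  | hadd a b ha hb => simp only [map_add, ha, hb]
  | @hpath e x y l =>
  simp only [map_smul, LinearMap.smul_apply]
  congr 3
  rename_i x₁ y₁ x₂ y₂
  simp only [← mul_def]
  by_cases h : y₂ = x₁
  · subst h
    rw [ofPath_mul_ofPath]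
    by_cases h' : y = x₂
    · subst h'
      rw [ofPath_mul_ofPath, ofPath_mul_ofPath, ofPath_mul_ofPath, Path.comp_assoc]
    · rw [ofPath_mul_ofPath_of_ne _ _ h', ofPath_mul_ofPath_of_ne _ _ h']
      exact (map_zero _).symm
  · rw [ofPath_mul_ofPath_of_ne _ _ h]
    by_cases h' : y = x₂
    · subst h'
      rw [ofPath_mul_ofPath, ofPath_mul_ofPath_of_ne _ _ h]
      exact LinearMap.congr_fun (map_zero mulL) _
    · rw [ofPath_mul_ofPath_of_ne _ _ h']
      exact (LinearMap.congr_fun (map_zero mulL) _).trans (map_zero _).symm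

instance [Fintype V] : Ring (PathAlgebra k V) where
  __ := (inferInstance : AddCommGroup (PathAlgebra k V))
  mul_assoc := mul_assoc_aux
  one_mul := one_mul_aux
  mul_one := mul_one_aux
  left_distrib r s t := map_add (mulL r) s t
  right_distrib r s t := LinearMap.congr_fun (map_add mulL r s) t
  zero_mul r := LinearMap.congr_fun (map_zero mulL) r
  mul_zero r := map_zero (mulL r)

instance [Fintype V] : Algebra k (PathAlgebra k V) :=
  Algebra.ofModule (fun c r s => LinearMap.congr_fun (map_smul mulL c r) s)
    (fun c r s => map_smul (mulL r) c s)

/-- The coefficient of a path in an element of the path algebra. -/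
def coeff (r : PathAlgebra k V) (p : TotalPath V) : k := Finsupp.toFun r p

/-- The set of the paths that appear with non-zero coefficient. -/
def support (r : PathAlgebra k V) : Finset (TotalPath V) := Finsupp.support r

open Classical in
/-- The subsum of `r` over the paths in `S`. -/
def subsum (S : Set (TotalPath V)) (r : PathAlgebra k V) : PathAlgebra k V :=
  Finsupp.filter (· ∈ S) r

theorem ext_coeff {r s : PathAlgebra k V} (h : ∀ p, r.coeff p = s.coeff p) : r = s :=
  Finsupp.ext h

theorem mem_support {r : PathAlgebra k V} {p : TotalPath V} : p ∈ r.support ↔ r.coeff p ≠ 0 :=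
  Finsupp.mem_support_iff

theorem coeff_zero (p : TotalPath V) : (0 : PathAlgebra k V).coeff p = 0 := rfl

theorem coeff_add (r s : PathAlgebra k V) (p : TotalPath V) :
    (r + s).coeff p = r.coeff p + s.coeff p := rfl

theorem coeff_smul (c : k) (r : PathAlgebra k V) (p : TotalPath V) :
    (c • r).coeff p = c * r.coeff p := rfl

open Classical in
theorem coeff_ofPath {x y : V} (q : Path x y) (p : TotalPath V) :
    (ofPath k q).coeff p = if (⟨x, y, q⟩ : TotalPath V) = p then 1 else 0 :=
  Finsupp.single_apply

open Classical in
theorem coeff_subsum (S : Set (TotalPath V)) (r : PathAlgebra k V) (p : TotalPath V) :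
    (subsum S r).coeff p = if p ∈ S then r.coeff p else 0 :=
  Finsupp.filter_apply _ _ _

/-- The idempotent of the path algebra given by a vertex. -/
def vertex (k : Type w) [Field k] {V : Type u} [Quiver.{v} V] (x : V) : PathAlgebra k V :=
  ofPath k (Path.nil : Path x x)

/-- The element of the path algebra given by an arrow. -/
def arrow (k : Type w) [Field k] {V : Type u} [Quiver.{v} V] {x y : V} (a : x ⟶ y) :
    PathAlgebra k V :=
  ofPath k a.toPath

end PathAlgebra

/-! ### Subquivers with the same vertices -/

section Sub

variable {V : Type u} [Quiver.{v} V]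

instance [Fintype V] (H : WideSubquiver V) : Fintype H := inferInstanceAs (Fintype V)

/-- The inclusion of a subquiver. -/
def subInclusion (H : WideSubquiver V) : H ⥤q V where
  obj x := x
  map a := a.1

/-- The inclusion of path algebras `kQ_B → kQ_A` that is induced by a subquiver `Q_B` of `Q_A`. -/
def pathInclusion (k : Type w) [Field k] [Fintype V] (H : WideSubquiver V) :
    PathAlgebra k H →ₐ[k] PathAlgebra k V :=
  AlgHom.ofLinearMap
    (PathAlgebra.lin fun p => PathAlgebra.ofPath k ((subInclusion H).mapPath p.path))
    (by
      rw [PathAlgebra.one_def, map_sum]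
      exact Finset.sum_congr rfl fun x _ => PathAlgebra.lin_ofPath _ _)
    (by
      intro r s
      induction r using PathAlgebra.induction with
      | h0 => simp
      | hadd a b ha hb => simp only [map_add, add_mul, ha, hb]
      | hpath c p =>
      induction s using PathAlgebra.induction with
      | h0 => simp
      | hadd a b ha hb => simp only [map_add, mul_add, ha, hb]
      | @hpath d x₂ y₂ q =>
      rename_i x₁ y₁
      simp only [map_smul, smul_mul_assoc, mul_smul_comm]
      congr 2
      by_cases h : y₂ = x₁
      · subst h
        simp only [PathAlgebra.ofPath_mul_ofPath, PathAlgebra.lin_ofPath, Prefunctor.mapPath_comp]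
      · rw [PathAlgebra.ofPath_mul_ofPath_of_ne _ _ h, PathAlgebra.lin_ofPath,
          PathAlgebra.lin_ofPath, map_zero]
        exact (PathAlgebra.ofPath_mul_ofPath_of_ne (k := k) ((subInclusion H).mapPath _)
          ((subInclusion H).mapPath _) h).symm)

end Sub

/-! ### Walks and the fundamental group of a bound quiver -/

section Walks

variable {V : Type u} [Quiver.{v} V]

/-- A walk is a path in the quiver in which a formal inverse of every arrow has been added. -/
def Walk (x y : V) := @Path (Symmetrify V) _ x y

namespace Walk

/-- The trivial walk at a vertex. -/
def nil {x : V} : Walk x x := @Path.nil (Symmetrify V) _ x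

/-- Composition of walks in diagrammatic order: first `p`, then `q`. -/
def comp {x y z : V} (p : Walk x y) (q : Walk y z) : Walk x z :=
  @Path.comp (Symmetrify V) _ x y z p q

/-- The inverse of a walk. -/
def inv {x y : V} (p : Walk x y) : Walk y x := @Path.reverse (Symmetrify V) _ _ x y p

/-- A path, viewed as a walk. -/
def ofPath {x y : V} (p : Path x y) : Walk x y := Symmetrify.of.mapPath p

/-- The walks in a subquiver. -/
abbrev _root_.RelHH.SubWalk (H : WideSubquiver V) (x y : V) := @Walk H _ x y

/-- A walk in a subquiver, viewed as a walk in the whole quiver. -/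
def ofSub {H : WideSubquiver V} {x y : V} (u : SubWalk H x y) : Walk x y :=
  (subInclusion H).symmetrify.mapPath u

theorem comp_assoc {x y z t : V} (p : Walk x y) (q : Walk y z) (r : Walk z t) :
    (p.comp q).comp r = p.comp (q.comp r) := Path.comp_assoc (V := Symmetrify V) p q r

theorem nil_comp {x y : V} (p : Walk x y) : nil.comp p = p := Path.nil_comp (V := Symmetrify V) p

theorem comp_nil {x y : V} (p : Walk x y) : p.comp nil = p := Path.comp_nil (V := Symmetrify V) p

theorem inv_inv {x y : V} (p : Walk x y) : p.inv.inv = p :=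
  Path.reverse_reverse (V := Symmetrify V) p

theorem inv_comp {x y z : V} (p : Walk x y) (q : Walk y z) :
    (p.comp q).inv = q.inv.comp p.inv := Path.reverse_comp (V := Symmetrify V) p q

theorem ofPath_comp {x y z : V} (p : Path x y) (q : Path y z) :
    ofPath (p.comp q) = (ofPath p).comp (ofPath q) := Symmetrify.of.mapPath_comp p q

theorem induction {x : V} {P : ∀ {y : V}, Walk x y → Prop} (h0 : P nil)
    (hpos : ∀ {y z : V} (p : Walk x y) (a : y ⟶ z), P p → P (p.comp (ofPath a.toPath)))
    (hneg : ∀ {y z : V} (p : Walk x y) (a : z ⟶ y), P p → P (p.comp (ofPath a.toPath).inv))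
    {y : V} (p : Walk x y) : P p := by
  change @Path (Symmetrify V) _ x y at p
  induction p with
  | nil => exact h0
  | cons p e ih =>
    rcases e with a | a
    · exact hpos p a ih
    · exact hneg p a ih

end Walk

variable {k : Type w} [Field k] [Fintype V]

/-- A minimal relation: an element `r` of `I` such that no proper (non-empty) subsum of `r`
lies in `I`. -/
def IsMinimalRelation (I : Ideal (PathAlgebra k V)) (r : PathAlgebra k V) : Prop :=
  r ∈ I ∧ ∀ S : Finset (TotalPath V), S ⊂ r.support → S.Nonempty → r.subsum S ∉ I

/-- The homotopy relation on walks. -/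
inductive Homotopic (I : Ideal (PathAlgebra k V)) : ∀ {x y : V}, Walk x y → Walk x y → Prop
  | refl {x y : V} (p : Walk x y) : Homotopic I p p
  | symm {x y : V} {p q : Walk x y} : Homotopic I p q → Homotopic I q p
  | trans {x y : V} {p q r : Walk x y} : Homotopic I p q → Homotopic I q r → Homotopic I p r
  | inv_mul {x y : V} (a : x ⟶ y) :
      Homotopic I ((Walk.ofPath a.toPath).comp (Walk.ofPath a.toPath).inv) Walk.nil
  | mul_inv {x y : V} (a : x ⟶ y) :
      Homotopic I ((Walk.ofPath a.toPath).inv.comp (Walk.ofPath a.toPath)) Walk.nil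
  | relation {x y : V} (r : PathAlgebra k V) (hr : IsMinimalRelation I r) (p q : Path x y)
      (hp : ⟨x, y, p⟩ ∈ r.support) (hq : ⟨x, y, q⟩ ∈ r.support) :
      Homotopic I (Walk.ofPath p) (Walk.ofPath q)
  | congr {x y z t : V} (p : Walk x y) {q q' : Walk y z} (r : Walk z t) :
      Homotopic I q q' → Homotopic I ((p.comp q).comp r) ((p.comp q').comp r)

variable {I : Ideal (PathAlgebra k V)}

theorem Homotopic.comp {x y z : V} {p p' : Walk x y} {q q' : Walk y z}
    (hp : Homotopic I p p') (hq : Homotopic I q q') : Homotopic I (p.comp q) (p'.comp q') := by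
  have h1 := Homotopic.congr Walk.nil q hp
  have h2 := Homotopic.congr p' Walk.nil hq
  simp only [Walk.nil_comp, Walk.comp_nil] at h1 h2
  exact h1.trans h2

theorem Homotopic.comp_inv {x y : V} (p : Walk x y) : Homotopic I (p.comp p.inv) Walk.nil := by
  induction p using Walk.induction with
  | h0 => exact .refl _
  | hpos p a ih =>
    have h := Homotopic.congr p p.inv (Homotopic.inv_mul (I := I) a)
    rw [Walk.comp_nil] at h
    rw [Walk.inv_comp]
    simp only [Walk.comp_assoc] at h ⊢
    exact h.trans ih
  | hneg p a ih =>
    have h := Homotopic.congr p p.inv (Homotopic.mul_inv (I := I) a)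
    rw [Walk.comp_nil] at h
    rw [Walk.inv_comp, Walk.inv_inv]
    simp only [Walk.comp_assoc] at h ⊢
    exact h.trans ih

theorem Homotopic.inv_comp {x y : V} (p : Walk x y) : Homotopic I (p.inv.comp p) Walk.nil := by
  have h := Homotopic.comp_inv (I := I) p.inv
  rwa [Walk.inv_inv] at h

theorem Homotopic.inv {x y : V} {p q : Walk x y} (h : Homotopic I p q) :
    Homotopic I p.inv q.inv := by
  have h1 := (Homotopic.refl p.inv).comp (Homotopic.comp_inv (I := I) q)
  have h2 := (Homotopic.inv_comp (I := I) p).comp (Homotopic.refl q.inv)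
  have h3 := Homotopic.congr p.inv q.inv h
  rw [Walk.comp_nil, ← Walk.comp_assoc] at h1
  rw [Walk.nil_comp] at h2
  exact h1.symm.trans (h3.symm.trans h2)

/-- Homotopy as an equivalence relation. -/
def homotopySetoid (I : Ideal (PathAlgebra k V)) (x y : V) : Setoid (Walk x y) where
  r := Homotopic I
  iseqv := ⟨.refl, .symm, .trans⟩

/-- The fundamental group `π₁(Q, I, b)`: closed walks at `b` up to homotopy. -/
def FundGroup (I : Ideal (PathAlgebra k V)) (b : V) := Quotient (homotopySetoid I b b)

namespace FundGroup

/-- The class of a closed walk. -/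
def mk (I : Ideal (PathAlgebra k V)) {b : V} (p : Walk b b) : FundGroup I b :=
  Quotient.mk (homotopySetoid I b b) p

theorem mk_eq {b : V} {p q : Walk b b} (h : Homotopic I p q) : mk I p = mk I q :=
  Quotient.sound h

/-- The product `[p] [q]` is the class of the walk `p q` (first `q`, then `p`). -/
instance (b : V) : Group (FundGroup I b) where
  mul := Quotient.map₂ (fun p q => q.comp p) fun _ _ hp _ _ hq => Homotopic.comp hq hp
  one := mk I Walk.nil
  inv := Quotient.map Walk.inv fun _ _ h => Homotopic.inv h
  mul_assoc := by
    rintro ⟨p⟩ ⟨q⟩ ⟨r⟩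
    exact congrArg (mk I) (Walk.comp_assoc r q p).symm
  one_mul := by
    rintro ⟨p⟩
    exact congrArg (mk I) (Walk.comp_nil p)
  mul_one := by
    rintro ⟨p⟩
    exact congrArg (mk I) (Walk.nil_comp p)
  inv_mul_cancel := by
    rintro ⟨p⟩
    exact mk_eq (Homotopic.comp_inv p)

theorem mk_mul_mk {b : V} (p q : Walk b b) : mk I p * mk I q = mk I (q.comp p) := rfl

theorem mk_inv {b : V} (p : Walk b b) : (mk I p)⁻¹ = mk I p.inv := rfl

theorem mk_nil {b : V} : mk I (Walk.nil : Walk b b) = 1 := rfl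

end FundGroup

/-- The subgroup `N_B` of `π₁(Q_A, I_A, b)`, generated by the classes of the closed walks
`v⁻¹ u'⁻¹ u v`, where `u` and `u'` are parallel walks in `Q_B` and `v` is a walk in `Q_A` that
starts at `b`. -/
def contractSubgroup (I : Ideal (PathAlgebra k V)) (H : WideSubquiver V) (b : V) :
    Subgroup (FundGroup I b) :=
  Subgroup.closure {g | ∃ (x y : V) (u u' : SubWalk H x y) (v : Walk b x),
    g = FundGroup.mk I (((v.comp (Walk.ofSub u)).comp (Walk.ofSub u').inv).comp v.inv)}

instance (I : Ideal (PathAlgebra k V)) (H : WideSubquiver V) (b : V) :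
    (contractSubgroup I H b).Normal where
  conj_mem n hn g := by
    induction hn using Subgroup.closure_induction with
    | mem n hn =>
      obtain ⟨x, y, u, u', v, rfl⟩ := hn
      induction g using Quotient.inductionOn with
      | h g =>
      refine Subgroup.subset_closure ⟨x, y, u, u', g.inv.comp v, ?_⟩
      refine congrArg (FundGroup.mk I) ?_
      change g.inv.comp (Walk.comp _ g) = _
      simp only [Walk.comp_assoc, Walk.inv_comp, Walk.inv_inv]
    | one => simp
    | mul a b _ _ ha hb =>
      have := Subgroup.mul_mem _ ha hb
      simpa [mul_assoc] using this
    | inv a _ ha =>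
      have := Subgroup.inv_mem _ ha
      simpa [mul_assoc] using this

end Walks

/-! ### First (relative) Hochschild cohomology -/

section Hochschild

variable (k : Type*) [Field k] {A : Type*} [Ring A] [Algebra k A]

instance (M : Submodule k (A →ₗ[k] A)) : AddCommGroup M := Submodule.addCommGroup M

variable (A) in
/-- The `k`-linear derivations of `A`. -/
def Der : Submodule k (A →ₗ[k] A) where
  carrier := {D | ∀ x y, D (x * y) = x * D y + D x * y}
  add_mem' {D E} hD hE x y := by
    simp only [LinearMap.add_apply, hD x y, hE x y, mul_add, add_mul]; abel
  zero_mem' x y := by simp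
  smul_mem' c D hD x y := by
    simp only [LinearMap.smul_apply, hD x y, smul_add, mul_smul_comm, smul_mul_assoc]

variable (A) in
/-- The inner derivations `x ↦ a x - x a` of `A`. -/
def Inn : Submodule k (A →ₗ[k] A) :=
  LinearMap.range (LinearMap.mul k A - (LinearMap.mul k A).flip)

variable (A) in
/-- The first Hochschild cohomology `HH¹(A)`: derivations modulo inner derivations. -/
abbrev HH1 := Der k A ⧸ (Inn k A).submoduleOf (Der k A)

variable {k}

/-- The linear maps `A → A` that are homomorphisms of `B`-bimodules. -/
def BimodHom (B : Subalgebra k A) : Submodule k (A →ₗ[k] A) where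
  carrier := {f | ∀ b ∈ B, ∀ x, f (b * x) = b * f x ∧ f (x * b) = f x * b}
  add_mem' {f g} hf hg b hb x := by
    simp only [LinearMap.add_apply, (hf b hb x).1, (hf b hb x).2, (hg b hb x).1, (hg b hb x).2,
      mul_add, add_mul, and_self]
  zero_mem' b _ x := by simp
  smul_mem' c f hf b hb x := by
    simp only [LinearMap.smul_apply, (hf b hb x).1, (hf b hb x).2, mul_smul_comm, smul_mul_assoc,
      and_self]

/-- The derivations of `A` that are homomorphisms of `B`-bimodules. -/
def DerRel (B : Subalgebra k A) : Submodule k (A →ₗ[k] A) := Der k A ⊓ BimodHom B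

/-- The inner derivations of `A` that are homomorphisms of `B`-bimodules. -/
def InnRel (B : Subalgebra k A) : Submodule k (A →ₗ[k] A) := Inn k A ⊓ BimodHom B

/-- The first relative Hochschild cohomology `HH¹(A|B)`. -/
abbrev HH1Rel (B : Subalgebra k A) := DerRel B ⧸ (InnRel B).submoduleOf (DerRel B)

/-- The canonical map `HH¹(A|B) → HH¹(A)`, which sends the class of a derivation to its class. -/
def hhInclusion (B : Subalgebra k A) : HH1Rel B →ₗ[k] HH1 k A :=
  Submodule.mapQ _ _ (Submodule.inclusion (inf_le_left : DerRel B ≤ Der k A))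
    fun _ hD => hD.1

end Hochschild

/-! ### Presentations -/

/-- A primitive idempotent of a ring. -/
def IsPrimitiveIdempotent {A : Type*} [Ring A] (e : A) : Prop :=
  IsIdempotentElem e ∧ e ≠ 0 ∧ ∀ f g : A, IsIdempotentElem f → IsIdempotentElem g →
    f * g = 0 → g * f = 0 → e = f + g → f = 0 ∨ g = 0

/-- A presentation of the algebra `A` by the quiver `V`: a surjective algebra map `ν : kQ → A`
under which the vertices correspond bijectively to a complete set of orthogonal idempotents
(the images of the vertices are automatically orthogonal idempotents with sum `1`). The kernel need
not be admissible. -/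
structure Presentation (k : Type*) [Field k] (A : Type*) [Ring A] [Algebra k A]
    (V : Type u) [Quiver.{v} V] [Fintype V] where
  map : PathAlgebra k V →ₐ[k] A
  surjective : Function.Surjective map
  vertex_injective : Function.Injective fun x : V => map (PathAlgebra.vertex k x)

/-- The ideal of relations of a presentation. -/
def Presentation.ideal {k : Type*} [Field k] {A : Type*} [Ring A] [Algebra k A]
    {V : Type u} [Quiver.{v} V] [Fintype V] (ν : Presentation k A V) : Ideal (PathAlgebra k V) :=
  RingHom.ker ν.map

/-- A presentation of `A` relative to the subalgebra `B`, where the quiver of `B` is a subquiver of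
the quiver of `A`. -/
structure RelPresentation {k : Type*} [Field k] {A : Type*} [Ring A] [Algebra k A]
    (B : Subalgebra k A) {V : Type u} [Quiver.{v} V] [Fintype V] (H : WideSubquiver V) where
  presA : Presentation k A V
  presB : Presentation k B H
  comm : ∀ r : PathAlgebra k H, presA.map (pathInclusion k H r) = (presB.map r : A)

/-! ### The maps from the dual fundamental groups to Hochschild cohomology -/

/-- A parade data with base point `b`: for every vertex `x` a walk from `b` to `x`. -/
abbrev ParadeData {V : Type u} [Quiver.{v} V] (b : V) := ∀ x : V, Walk b x

/-- The connected component of a vertex in a subquiver. -/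
def component {V : Type u} [Quiver.{v} V] (H : WideSubquiver V) (x : V) :
    WeaklyConnectedComponent H :=
  WeaklyConnectedComponent.mk (V := H) x

/-- A relative parade data: for every connected component of `Q_B` a vertex of that component and
a walk in `Q_A` from the base point to this vertex, and for every vertex `y` a walk in `Q_B` to `y`
from the chosen vertex of the component of `y`. -/
structure RelParadeData {V : Type u} [Quiver.{v} V] (H : WideSubquiver V) (b : V) where
  root : WeaklyConnectedComponent H → V
  root_mem : ∀ c, component H (root c) = c
  toRoot : ∀ c, Walk b (root c)
  fromRoot : ∀ y : V, SubWalk H (root (component H y)) y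

/-- The parade data that is given by a relative parade data. -/
def RelParadeData.parade {V : Type u} [Quiver.{v} V] {H : WideSubquiver V} {b : V}
    (γ : RelParadeData H b) : ParadeData b :=
  fun y => (γ.toRoot (component H y)).comp (Walk.ofSub (γ.fromRoot y))

section Theta

variable {k : Type*} [Field k] {A : Type*} [Ring A] [Algebra k A]
  {V : Type u} [Quiver.{v} V] [Fintype V]

/-- The group of homomorphisms from a group to the additive group of the field, as a vector
space. -/
abbrev DualGroup (k : Type*) [Field k] (G : Type*) [Group G] := Additive G →+ k

/-- The map `Hom(G/N, k) → Hom(G, k)` induced by the projection `G → G/N`. -/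
def dualInclusion (k : Type*) [Field k] {G : Type*} [Group G] (N : Subgroup G) [N.Normal] :
    DualGroup k (G ⧸ N) →ₗ[k] DualGroup k G where
  toFun f := f.comp (MonoidHom.toAdditive (QuotientGroup.mk' N))
  map_add' _ _ := rfl
  map_smul' _ _ := rfl

/-- The closed walk `γ_{t(p)}⁻¹ p γ_{s(p)}` at the base point, as an element of the fundamental
group. -/
def cl (I : Ideal (PathAlgebra k V)) {b : V} (γ : ParadeData b) {x y : V} (p : Path x y) :
    FundGroup I b :=
  FundGroup.mk I (((γ x).comp (Walk.ofPath p)).comp (γ y).inv)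

theorem cl_comp (I : Ideal (PathAlgebra k V)) {b : V} (γ : ParadeData b) {x y z : V}
    (p : Path x y) (q : Path y z) :
    cl I γ (p.comp q) = cl I γ q * cl I γ p := by
  refine FundGroup.mk_eq ?_
  have h := Homotopic.congr ((γ x).comp (Walk.ofPath p)) ((Walk.ofPath q).comp (γ z).inv)
    (Homotopic.inv_comp (I := I) (γ y))
  rw [Walk.comp_nil] at h
  rw [Walk.ofPath_comp]
  simp only [Walk.comp_assoc] at h ⊢
  exact h.symm

theorem cl_congr (I : Ideal (PathAlgebra k V)) {b : V} (γ : ParadeData b) {x y : V}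
    {p q : Path x y} (h : Homotopic I (Walk.ofPath p) (Walk.ofPath q)) :
    cl I γ p = cl I γ q :=
  FundGroup.mk_eq (Homotopic.congr (γ x) (γ y).inv h)

/-- The linear map `p ↦ f(cl_γ(p)) p` from the path algebra to itself. -/
def diagonal (I : Ideal (PathAlgebra k V)) {b : V} (γ : ParadeData b)
    (f : DualGroup k (FundGroup I b)) : PathAlgebra k V →ₗ[k] PathAlgebra k V :=
  PathAlgebra.lin fun p => f (Additive.ofMul (cl I γ p.path)) • PathAlgebra.ofPath k p.path

theorem diagonal_ofPath (I : Ideal (PathAlgebra k V)) {b : V} (γ : ParadeData b)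
    (f : DualGroup k (FundGroup I b)) {x y : V} (p : Path x y) :
    diagonal I γ f (PathAlgebra.ofPath k p) =
      f (Additive.ofMul (cl I γ p)) • PathAlgebra.ofPath k p :=
  PathAlgebra.lin_ofPath _ _

theorem diagonal_mul (I : Ideal (PathAlgebra k V)) {b : V} (γ : ParadeData b)
    (f : DualGroup k (FundGroup I b)) (r s : PathAlgebra k V) :
    diagonal I γ f (r * s) = r * diagonal I γ f s + diagonal I γ f r * s := by
  induction r using PathAlgebra.induction with
  | h0 => simp
  | hadd a b ha hb => simp only [map_add, add_mul, ha, hb]; abel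
  | hpath c p =>
  induction s using PathAlgebra.induction with
  | h0 => simp
  | hadd a b ha hb => simp only [map_add, mul_add, ha, hb]; abel
  | @hpath d x₂ y₂ q =>
  rename_i x₁ y₁
  simp only [map_smul, smul_mul_assoc, mul_smul_comm, diagonal_ofPath]
  by_cases h : y₂ = x₁
  · subst h
    rw [PathAlgebra.ofPath_mul_ofPath, diagonal_ofPath, cl_comp, ofMul_mul, map_add]
    module
  · simp [PathAlgebra.ofPath_mul_ofPath_of_ne _ _ h]

/-- Multiplication by vertices on both sides picks out the paths between the two vertices. -/
theorem vertex_mul_mul_vertex (x y : V) (r : PathAlgebra k V) :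
    PathAlgebra.vertex k y * r * PathAlgebra.vertex k x =
      r.subsum {p | p.src = x ∧ p.tgt = y} := by
  classical
  refine PathAlgebra.ext_coeff fun q => ?_
  rw [PathAlgebra.coeff_subsum]
  induction r using PathAlgebra.induction with
  | h0 => simp [PathAlgebra.coeff_zero]
  | hadd a b ha hb =>
    rw [mul_add, add_mul, PathAlgebra.coeff_add, ha, hb, PathAlgebra.coeff_add]
    split_ifs <;> simp
  | @hpath c z t p =>
    rw [mul_smul_comm, smul_mul_assoc, PathAlgebra.coeff_smul, PathAlgebra.coeff_smul,
      PathAlgebra.coeff_ofPath]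
    unfold PathAlgebra.vertex
    by_cases ht : t = y
    · subst ht
      rw [PathAlgebra.ofPath_mul_ofPath, Path.comp_nil]
      by_cases hz : z = x
      · subst hz
        rw [PathAlgebra.ofPath_mul_ofPath, Path.nil_comp, PathAlgebra.coeff_ofPath]
        by_cases hq : (⟨z, t, p⟩ : TotalPath V) = q
        · subst hq; simp
        · simp [hq]
      · rw [PathAlgebra.ofPath_mul_ofPath_of_ne _ _ (Ne.symm hz), PathAlgebra.coeff_zero]
        by_cases hq : (⟨z, t, p⟩ : TotalPath V) = q
        · subst hq; simp [hz]
        · simp [hq]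
    · rw [PathAlgebra.ofPath_mul_ofPath_of_ne _ _ ht, zero_mul, PathAlgebra.coeff_zero]
      by_cases hq : (⟨z, t, p⟩ : TotalPath V) = q
      · subst hq; simp [ht]
      · simp [hq]

theorem minimal_parallel (I : Ideal (PathAlgebra k V)) (hI : ∀ r s, r ∈ I → r * s ∈ I)
    {r : PathAlgebra k V} (hr : IsMinimalRelation I r) {p q : TotalPath V}
    (hp : p ∈ r.support) (hq : q ∈ r.support) : q.src = p.src ∧ q.tgt = p.tgt := by
  classical
  by_contra h
  refine hr.2 (r.support.filter fun q => q.src = p.src ∧ q.tgt = p.tgt)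
    (Finset.filter_ssubset.2 ⟨q, hq, h⟩) ⟨p, by simpa using hp⟩ ?_
  have h1 := hI _ (PathAlgebra.vertex k p.src)
    (I.mul_mem_left (PathAlgebra.vertex k p.tgt) hr.1)
  rw [vertex_mul_mul_vertex] at h1
  convert h1 using 1
  refine PathAlgebra.ext_coeff fun l => ?_
  rw [PathAlgebra.coeff_subsum, PathAlgebra.coeff_subsum]
  by_cases hl : r.coeff l = 0
  · simp [hl]
  · simp [PathAlgebra.mem_support.2 hl]

theorem coeff_diagonal (I : Ideal (PathAlgebra k V)) {b : V} (γ : ParadeData b)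
    (f : DualGroup k (FundGroup I b)) (r : PathAlgebra k V) (p : TotalPath V) :
    (diagonal I γ f r).coeff p = f (Additive.ofMul (cl I γ p.path)) * r.coeff p := by
  classical
  induction r using PathAlgebra.induction with
  | h0 => rw [map_zero, PathAlgebra.coeff_zero, mul_zero]
  | hadd a b ha hb => rw [map_add, PathAlgebra.coeff_add, ha, hb, PathAlgebra.coeff_add, mul_add]
  | @hpath c z t q =>
    rw [map_smul, diagonal_ofPath, PathAlgebra.coeff_smul, PathAlgebra.coeff_smul,
      PathAlgebra.coeff_smul, PathAlgebra.coeff_ofPath]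
    by_cases h : (⟨z, t, q⟩ : TotalPath V) = p
    · subst h; ring
    · simp [h]

theorem diagonal_mem (I : Ideal (PathAlgebra k V)) (hI : ∀ r s, r ∈ I → r * s ∈ I)
    {b : V} (γ : ParadeData b)
    (f : DualGroup k (FundGroup I b)) (r : PathAlgebra k V) (hr : r ∈ I) :
    diagonal I γ f r ∈ I := by
  classical
  induction h : r.support.card using Nat.strong_induction_on generalizing r with
  | _ n ih =>
  by_cases hmin : IsMinimalRelation I r
  · by_cases h0 : r.support.Nonempty
    · obtain ⟨p, hp⟩ := h0
      have key : diagonal I γ f r = f (Additive.ofMul (cl I γ p.path)) • r := by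
        refine PathAlgebra.ext_coeff fun q => ?_
        rw [coeff_diagonal, PathAlgebra.coeff_smul]
        by_cases hq : q ∈ r.support
        · obtain ⟨h1, h2⟩ := minimal_parallel I hI hmin hp hq
          obtain ⟨x, y, p⟩ := p
          obtain ⟨x', y', q⟩ := q
          obtain rfl : x' = x := h1
          obtain rfl : y' = y := h2
          rw [cl_congr I γ (Homotopic.relation r hmin q p hq hp)]
        · have h2 : r.coeff q = 0 := by simpa [PathAlgebra.mem_support] using hq
          rw [h2, mul_zero, mul_zero]
      rw [key, ← one_mul r, ← smul_mul_assoc]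
      exact I.mul_mem_left _ hr
    · have : r = 0 := PathAlgebra.ext_coeff fun p => by
        by_contra hp
        exact h0 ⟨p, PathAlgebra.mem_support.2 hp⟩
      rw [this, map_zero]
      exact I.zero_mem
  · have h1 : ¬ ∀ S : Finset (TotalPath V), S ⊂ r.support → S.Nonempty → r.subsum S ∉ I :=
      fun h => hmin ⟨hr, h⟩
    push Not at h1
    obtain ⟨S, hS, hne, hr₁⟩ := h1
    have hsum : r.subsum S + r.subsum (S : Set (TotalPath V))ᶜ = r :=
      PathAlgebra.ext_coeff fun p => by
        rw [PathAlgebra.coeff_add, PathAlgebra.coeff_subsum, PathAlgebra.coeff_subsum]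
        by_cases hp : p ∈ S <;> simp [hp]
    have hr₂ : r.subsum (S : Set (TotalPath V))ᶜ ∈ I := by
      rw [← add_sub_cancel_left (r.subsum S) (r.subsum (S : Set (TotalPath V))ᶜ), hsum]
      exact I.sub_mem hr hr₁
    have c₁ : (r.subsum S).support.card < n := by
      rw [← h]
      refine Finset.card_lt_card (lt_of_le_of_lt (fun p hp => ?_) hS)
      rw [PathAlgebra.mem_support, PathAlgebra.coeff_subsum] at hp
      by_contra hpS
      simp [hpS] at hp
    have c₂ : (r.subsum (S : Set (TotalPath V))ᶜ).support.card < n := by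
      rw [← h]
      obtain ⟨p, hp⟩ := hne
      refine Finset.card_lt_card (Finset.ssubset_iff_subset_ne.2 ⟨fun q hq => ?_, fun e => ?_⟩)
      · rw [PathAlgebra.mem_support, PathAlgebra.coeff_subsum] at hq
        rw [PathAlgebra.mem_support]
        intro h0
        simp [h0] at hq
      · have := hS.1 hp
        rw [← e, PathAlgebra.mem_support, PathAlgebra.coeff_subsum] at this
        simp [hp] at this
    rw [← hsum, map_add]
    exact I.add_mem (ih _ c₁ _ hr₁ rfl) (ih _ c₂ _ hr₂ rfl)

/-- The derivation `p ↦ f(cl_γ(p)) p` of `A`. -/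
def thetaEnd (ν : Presentation k A V) {b : V} (γ : ParadeData b)
    (f : DualGroup k (FundGroup ν.ideal b)) : A →ₗ[k] A :=
  (LinearMap.ker ν.map.toLinearMap).liftQ (ν.map.toLinearMap ∘ₗ diagonal ν.ideal γ f)
    (fun r hr => diagonal_mem ν.ideal
      (fun r s h => by
        have h' : ν.map r = 0 := h
        change ν.map (r * s) = 0
        rw [map_mul, h', zero_mul]) γ f r hr) ∘ₗ
    (ν.map.toLinearMap.quotKerEquivOfSurjective ν.surjective).symm.toLinearMap

theorem thetaEnd_map (ν : Presentation k A V) {b : V} (γ : ParadeData b)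
    (f : DualGroup k (FundGroup ν.ideal b)) (r : PathAlgebra k V) :
    thetaEnd ν γ f (ν.map r) = ν.map (diagonal ν.ideal γ f r) := by
  have h : (ν.map.toLinearMap.quotKerEquivOfSurjective ν.surjective).symm (ν.map r) =
      Submodule.Quotient.mk r := by
    rw [LinearEquiv.symm_apply_eq]; rfl
  rw [thetaEnd, LinearMap.comp_apply, LinearEquiv.coe_coe, h]
  rfl

/-- The characterization of the derivation by its values on paths. -/
theorem thetaEnd_ofPath (ν : Presentation k A V) {b : V} (γ : ParadeData b)
    (f : DualGroup k (FundGroup ν.ideal b)) {x y : V} (p : Path x y) :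
    thetaEnd ν γ f (ν.map (PathAlgebra.ofPath k p)) =
      f (Additive.ofMul (cl ν.ideal γ p)) • ν.map (PathAlgebra.ofPath k p) := by
  rw [thetaEnd_map, diagonal_ofPath, map_smul]

/-- The map `θ_{ν,γ} : Hom(π₁(Q, I), k) → Der(A)`, `f ↦ (p ↦ f(cl_γ(p)) p)`. -/
def thetaDer (ν : Presentation k A V) {b : V} (γ : ParadeData b) :
    DualGroup k (FundGroup ν.ideal b) →ₗ[k] Der k A where
  toFun f := ⟨thetaEnd ν γ f, fun x y => by
    obtain ⟨r, rfl⟩ := ν.surjective x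
    obtain ⟨s, rfl⟩ := ν.surjective y
    rw [← map_mul, thetaEnd_map, thetaEnd_map, thetaEnd_map, diagonal_mul, map_add, map_mul,
      map_mul]⟩
  map_add' f g := by
    refine Subtype.ext (LinearMap.ext fun x => ?_)
    obtain ⟨r, rfl⟩ := ν.surjective x
    change thetaEnd ν γ (f + g) (ν.map r) = thetaEnd ν γ f (ν.map r) + thetaEnd ν γ g (ν.map r)
    have h : diagonal ν.ideal γ (f + g) = diagonal ν.ideal γ f + diagonal ν.ideal γ g :=
      PathAlgebra.hom_ext fun p => by
        simp only [diagonal_ofPath, LinearMap.add_apply, AddMonoidHom.add_apply, add_smul]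
    rw [thetaEnd_map, thetaEnd_map, thetaEnd_map, h, LinearMap.add_apply, map_add]
  map_smul' c f := by
    refine Subtype.ext (LinearMap.ext fun x => ?_)
    obtain ⟨r, rfl⟩ := ν.surjective x
    change thetaEnd ν γ (c • f) (ν.map r) = c • thetaEnd ν γ f (ν.map r)
    have h : diagonal ν.ideal γ (c • f) = c • diagonal ν.ideal γ f :=
      PathAlgebra.hom_ext fun p => by
        simp only [diagonal_ofPath, LinearMap.smul_apply, AddMonoidHom.smul_apply, smul_assoc]
    rw [thetaEnd_map, thetaEnd_map, h, LinearMap.smul_apply, map_smul]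

/-- The map `θ_ν : Hom(π₁(Q, I), k) → HH¹(A)`, computed with the parade data `γ`. -/
def theta (ν : Presentation k A V) {b : V} (γ : ParadeData b) :
    DualGroup k (FundGroup ν.ideal b) →ₗ[k] HH1 k A :=
  ((Inn k A).submoduleOf (Der k A)).mkQ ∘ₗ thetaDer ν γ

end Theta

/-- A commutative square of vector spaces
```
  Y --g--> Z
  ^        ^
  i        j
  |        |
  W --h--> X
```
is a pullback square if it has the universal property of a pullback. -/
def IsPullbackSquare.{t, u₀, u₁, u₂, u₃, u₄} {k : Type u₀} {W : Type u₁} {X : Type u₂}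
    {Y : Type u₃} {Z : Type u₄} [Field k] [AddCommGroup W] [Module k W]
    [AddCommGroup X] [Module k X] [AddCommGroup Y] [Module k Y] [AddCommGroup Z] [Module k Z]
    (i : W →ₗ[k] Y) (h : W →ₗ[k] X) (g : Y →ₗ[k] Z) (j : X →ₗ[k] Z) : Prop :=
  g ∘ₗ i = j ∘ₗ h ∧
    ∀ (U : Type t) [AddCommGroup U] [Module k U] (α : U →ₗ[k] Y) (β : U →ₗ[k] X),
      g ∘ₗ α = j ∘ₗ β → ∃! φ : U →ₗ[k] W, i ∘ₗ φ = α ∧ h ∘ₗ φ = β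

end RelHH

end

open RelHH

universe t u₀ u₁ u₂ u₃

/-! The derivation `θ_{ν,γ}(f)` is diagonal on paths, with eigenvalue `f(cl_γ(α))` on an arrow `α`.
The core is `exists_potential`. Suppose that on some arrows this derivation agrees with the
commutator with an element `s` that commutes with all vertices `e_x`. Since `k` is algebraically
closed and `e_x` is primitive, `s e_x` is `c_x e_x` plus a nilpotent element. For `α : x → y` the
operator `α ↦ sα - αs` is then `c_y - c_x` plus a difference of two commuting nilpotent operators,
so `α ≠ 0` forces `f(cl_γ(α)) = c_y - c_x`. Admissibility of the ideal plays no role.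

If the derivation is inner, this potential formula holds on all arrows; then `f` vanishes on closed
walks, which gives `theta_injective`. If it is only cohomologous to a derivation that kills `B`, the
formula holds on the arrows of `Q_B`. Then parallel walks in `Q_B` have the same value, so `f` kills
`N_B` and factors through the quotient: `mem_range_dualInclusion_of_theta_eq`.

Conversely, for a relative parade data the class of a walk in `Q_B` is a generator of `N_B`
(`walkClass_parade_mem`), so `θ_{ν,γ}(ι f)` kills `B`, which for a derivation means being
`B`-bilinear (`mem_DerRel_iff`). Both vertical maps of the square are injective, so the pullback
property is just the lifting statement above. A change of parade data alters the derivation by the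
commutator with a combination of vertices (`thetaDer_sub_mem_Inn`). -/

namespace RelHH

/-! ### Primitive idempotents of finite-dimensional algebras -/

section Primitive

variable {k : Type*} [Field k] {A : Type*} [Ring A] [Algebra k A]

variable (k) in
open Polynomial in
/-- In a finite-dimensional algebra, an element `b` of the corner of a primitive idempotent `e` is
either nilpotent or left invertible in the corner. -/
theorem IsPrimitiveIdempotent.isNilpotent_or_exists_mul_eq [FiniteDimensional k A] {e b : A}
    (he : IsPrimitiveIdempotent e) (heb : e * b = b) (hbe : b * e = b) :
    IsNilpotent b ∨ ∃ c : A, c * b = e := by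
  have hm : minpoly k b ≠ 0 := minpoly.ne_zero (Algebra.IsIntegral.isIntegral b)
  obtain ⟨g, hg, hXg⟩ := Polynomial.exists_eq_pow_rootMultiplicity_mul_and_not_dvd _ hm 0
  set n := (minpoly k b).rootMultiplicity 0
  rw [C_0, sub_zero] at hg hXg
  -- Fitting decomposition inside `k[b]`: a Bézout identity for the two coprime factors yields
  -- complementary idempotents `w`, `w'`. The exponent `n + 1` in place of `n` makes `w` a multiple
  -- of `b` even when `n = 0`.
  have hcop : IsCoprime (X ^ (n + 1) : k[X]) g :=
    IsCoprime.pow_left ((Polynomial.irreducible_X.coprime_iff_not_dvd).2 hXg)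
  obtain ⟨u, v, huv⟩ := hcop
  set w : A := aeval b (u * X ^ (n + 1)) with hw
  set w' : A := aeval b (v * g) with hw'
  have hsum : w + w' = 1 := by rw [hw, hw', ← map_add, huv, map_one]
  have hzero : aeval b (X ^ n * g) = 0 := by rw [← hg, minpoly.aeval]
  have hww' : w * w' = 0 := by
    rw [hw, hw', ← map_mul, show u * X ^ (n + 1) * (v * g) = (u * v * X) * (X ^ n * g) by ring,
      map_mul, hzero, mul_zero]
  have hw'w : w' * w = 0 := by
    rw [← hww', hw, hw', ← map_mul, ← map_mul, mul_comm]
  have hwi : w * w = w := by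
    have := congrArg (w * ·) hsum
    simpa [mul_add, hww'] using this
  have hwi' : w' * w' = w' := by
    have := congrArg (w' * ·) hsum
    simpa [mul_add, hw'w] using this
  have hcomm : ∀ q : k[X], Commute e (aeval b q) := fun q => by
    have h : Commute e b := heb.trans hbe.symm
    induction q using Polynomial.induction_on' with
    | add p q hp hq => rw [map_add]; exact hp.add_right hq
    | monomial m c =>
      rw [aeval_monomial]
      exact (Algebra.commute_algebraMap_right c e).mul_right (h.pow_right m)
  have hce : Commute e w := hcomm _
  have hce' : Commute e w' := hcomm _
  have hee : e * e = e := he.1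
  have hpow : b ^ (n + 1) * w = b ^ (n + 1) := by
    have h : b ^ (n + 1) * w' = 0 := by
      rw [hw', show b ^ (n + 1) = aeval b (X ^ (n + 1) : k[X]) by simp, ← map_mul,
        show (X ^ (n + 1) * (v * g) : k[X]) = (v * X) * (X ^ n * g) by ring, map_mul, hzero,
        mul_zero]
    have := congrArg (b ^ (n + 1) * ·) hsum
    simpa [mul_add, h] using this
  have hmul : ∀ s t : A, Commute e s → e * s * (e * t) = e * (s * t) := fun s t hs => by
    rw [hs.eq, mul_assoc, ← mul_assoc e e, hee, ← mul_assoc, ← hs.eq, mul_assoc]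
  -- Here `e = e w + e w'` is an orthogonal decomposition, so primitivity kills one summand. If `e w
  -- = 0`, then `b ^ (n + 1) = b ^ (n + 1) w = 0`; otherwise `e = e w`, and `w` ends in a factor
  -- `b`.
  rcases he.2.2 (e * w) (e * w') ((hmul w w hce).trans (by rw [hwi]))
    ((hmul w' w' hce').trans (by rw [hwi'])) ((hmul w w' hce).trans (by rw [hww', mul_zero]))
    ((hmul w' w hce').trans (by rw [hw'w, mul_zero])) (by rw [← mul_add, hsum, mul_one])
    with h | h
  · left
    refine ⟨n + 1, ?_⟩
    rw [← hpow, pow_succ, mul_assoc, ← hbe, mul_assoc, h, mul_zero, mul_zero]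
  · right
    refine ⟨e * (aeval b u * b ^ n), ?_⟩
    have h1 : aeval b u * b ^ n * b = w := by
      rw [hw, map_mul, map_pow, aeval_X, pow_succ, mul_assoc]
    have h2 : e * w + e * w' = e := by rw [← mul_add, hsum, mul_one]
    rwa [h, add_zero, ← h1, ← mul_assoc] at h2

/-- Over an algebraically closed field, an element of the corner of a primitive idempotent `e` is
the sum of a scalar multiple of `e` and a nilpotent element. -/
theorem IsPrimitiveIdempotent.exists_isNilpotent_sub_smul [FiniteDimensional k A] [IsAlgClosed k]
    {e a : A}
    (he : IsPrimitiveIdempotent e) (hea : e * a = a) (hae : a * e = a) :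
    ∃ c : k, IsNilpotent (a - c • e) := by
  have hee : e * e = e := he.1
  -- The right ideal `eA` is non-zero and stable under left multiplication by `a`; the scalar is an
  -- eigenvalue of this operator.
  let W : Submodule k A := LinearMap.range (LinearMap.mulLeft k e)
  have hW : ∀ x ∈ W, LinearMap.mulLeft k a x ∈ W := fun x _ =>
    ⟨a * x, by simp [← mul_assoc, hea]⟩
  have heW : e ∈ W := ⟨e, hee⟩
  have : Nontrivial W := ⟨⟨⟨e, heW⟩, 0, fun h => he.2.1 (congrArg Subtype.val h)⟩⟩
  obtain ⟨c, hc⟩ := Module.End.exists_eigenvalue ((LinearMap.mulLeft k a).restrict hW)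
  obtain ⟨x, hx⟩ := hc.exists_hasEigenvector
  have hax : a * (x : A) = c • (x : A) := congrArg Subtype.val hx.apply_eq_smul
  have hex : e * (x : A) = x := by
    obtain ⟨y, hy⟩ := x.2
    rw [← hy, LinearMap.mulLeft_apply, ← mul_assoc, hee]
  refine ⟨c, ?_⟩
  rcases he.isNilpotent_or_exists_mul_eq k (b := a - c • e)
    (by rw [mul_sub, hea, mul_smul_comm, hee]) (by rw [sub_mul, hae, smul_mul_assoc, hee])
    with h | ⟨d, hd⟩
  · exact h
  -- A left inverse `d` of `a - c • e` would give `x = e x = d (a - c e) x = 0` for the eigenvector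
  -- `x`.
  · refine absurd ?_ hx.2
    refine Subtype.ext ?_
    rw [← hex, ← hd, mul_assoc, sub_mul, hax, smul_mul_assoc, hex, sub_self, mul_zero]
    rfl

/-- If `m` and `n` are nilpotent, then `0` is the only eigenvalue of `x ↦ m x - x n`. -/
theorem eq_zero_of_mul_sub_mul_eq_smul {m n x : A} (hm : IsNilpotent m) (hn : IsNilpotent n)
    {c : k} (hx : x ≠ 0) (h : m * x - x * n = c • x) : c = 0 := by
  -- Left and right multiplications commute, so their difference is again nilpotent, and some power
  -- of its eigenvalue `c` is zero.
  have hT : IsNilpotent (LinearMap.mulLeft k m - LinearMap.mulRight k n) :=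
    (LinearMap.commute_mulLeft_right m n).isNilpotent_sub
      ((LinearMap.isNilpotent_mulLeft_iff k m).2 hm) ((LinearMap.isNilpotent_mulRight_iff k n).2 hn)
  obtain ⟨N, hN⟩ := hT
  have hpow : ∀ i : ℕ, ((LinearMap.mulLeft k m - LinearMap.mulRight k n) ^ i) x = c ^ i • x := by
    intro i
    induction i with
    | zero => simp
    | succ i ih =>
      rw [pow_succ', Module.End.mul_apply, ih, map_smul, LinearMap.sub_apply,
        LinearMap.mulLeft_apply, LinearMap.mulRight_apply, h, smul_smul, pow_succ]
  have := hpow N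
  rw [hN, LinearMap.zero_apply] at this
  exact eq_zero_of_pow_eq_zero ((smul_eq_zero.1 this.symm).resolve_right hx)

end Primitive

/-! ### Classes of walks -/

section WalkClass

theorem Walk.ofSub_comp {V : Type u} [Quiver.{v} V] {H : WideSubquiver V} {x y z : V}
    (p : SubWalk H x y) (q : SubWalk H y z) :
    Walk.ofSub (H := H) (@Walk.comp H _ x y z p q) = (Walk.ofSub p).comp (Walk.ofSub q) :=
  (subInclusion H).symmetrify.mapPath_comp p q

/-- Induction on the walks that come from a subquiver. -/
theorem Walk.ofSub_induction {V : Type u} [Quiver.{v} V] {H : WideSubquiver V} {x : V}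
    {P : ∀ {y : V}, Walk x y → Prop} (h0 : P Walk.nil)
    (hpos : ∀ {y z : V} (p : Walk x y) (a : y ⟶ z), a ∈ H y z → P p →
      P (p.comp (Walk.ofPath a.toPath)))
    (hneg : ∀ {y z : V} (p : Walk x y) (a : z ⟶ y), a ∈ H z y → P p →
      P (p.comp (Walk.ofPath a.toPath).inv))
    {y : V} (w : SubWalk H x y) : P (Walk.ofSub w) :=
  Walk.induction (V := H) (x := x) (P := fun {y} w => P (y := y) (Walk.ofSub w)) h0
    (fun p a ih => hpos (Walk.ofSub p) a.1 a.2 ih)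
    (fun p a ih => hneg (Walk.ofSub p) a.1 a.2 ih) w

variable {k : Type*} [Field k] {V : Type u} [Quiver.{v} V] [Fintype V]
  {I : Ideal (PathAlgebra k V)} {b : V}

/-- The class of the closed walk `γ_y⁻¹ w γ_x` at the base point, for a walk `w` from `x` to `y`. -/
noncomputable def walkClass (I : Ideal (PathAlgebra k V)) (γ : ParadeData b) {x y : V} (w : Walk x y) :
    FundGroup I b :=
  FundGroup.mk I (((γ x).comp w).comp (γ y).inv)

theorem walkClass_ofPath (γ : ParadeData b) {x y : V} (p : Path x y) :
    walkClass I γ (Walk.ofPath p) = cl I γ p := rfl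

theorem walkClass_nil (γ : ParadeData b) (x : V) :
    walkClass I γ (Walk.nil : Walk x x) = 1 := by
  refine FundGroup.mk_eq ?_
  rw [Walk.comp_nil]
  exact Homotopic.comp_inv _

/-- The detour `γ_y⁻¹` followed by `γ_y` between the two factors is null-homotopic. The order is
reversed because `comp` is diagrammatic and the group product is not. -/
theorem walkClass_comp (γ : ParadeData b) {x y z : V} (p : Walk x y) (q : Walk y z) :
    walkClass I γ (p.comp q) = walkClass I γ q * walkClass I γ p := by
  refine FundGroup.mk_eq ?_
  have h := Homotopic.congr ((γ x).comp p) (q.comp (γ z).inv) (Homotopic.inv_comp (I := I) (γ y))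
  rw [Walk.comp_nil] at h
  simp only [Walk.comp_assoc] at h ⊢
  exact h.symm

theorem walkClass_inv (γ : ParadeData b) {x y : V} (p : Walk x y) :
    walkClass I γ p.inv = (walkClass I γ p)⁻¹ := by
  rw [walkClass, walkClass, FundGroup.mk_inv]
  simp only [Walk.inv_comp, Walk.inv_inv, Walk.comp_assoc]

theorem walkClass_closed (γ : ParadeData b) (w : Walk b b) :
    walkClass I γ w = (FundGroup.mk I (γ b))⁻¹ * FundGroup.mk I w * FundGroup.mk I (γ b) := by
  rw [FundGroup.mk_inv, FundGroup.mk_mul_mk, FundGroup.mk_mul_mk]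
  exact congrArg (FundGroup.mk I) (Walk.comp_assoc _ _ _)

/-- The walk `γ b` need not be trivial, but it only conjugates the class, which a homomorphism to a
commutative group does not see. -/
theorem dual_walkClass_closed (γ : ParadeData b) (f : DualGroup k (FundGroup I b))
    (w : Walk b b) :
    f (Additive.ofMul (walkClass I γ w)) = f (Additive.ofMul (FundGroup.mk I w)) := by
  rw [walkClass_closed, ofMul_mul, ofMul_mul, ofMul_inv, map_add, map_add, map_neg]
  ring

/-- A homomorphism that is a difference of a potential on the arrows of a subquiver is the
difference of this potential on all walks of the subquiver. -/
theorem dual_walkClass_ofSub (γ : ParadeData b) (f : DualGroup k (FundGroup I b)) (c : V → k)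
    {H : WideSubquiver V}
    (hc : ∀ {x y : V} (a : x ⟶ y), a ∈ H x y → f (Additive.ofMul (cl I γ a.toPath)) = c y - c x)
    {x y : V} (w : SubWalk H x y) :
    f (Additive.ofMul (walkClass I γ (Walk.ofSub w))) = c y - c x := by
  refine Walk.ofSub_induction (x := x)
    (P := fun {y} w => f (Additive.ofMul (walkClass I γ w)) = c y - c x) ?_ ?_ ?_ w
  · rw [walkClass_nil, ofMul_one, map_zero, sub_self]
  · intro y z p a ha ih
    rw [walkClass_comp, ofMul_mul, map_add, ih, walkClass_ofPath, hc a ha]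
    ring
  · intro y z p a ha ih
    rw [walkClass_comp, walkClass_inv, ofMul_mul, ofMul_inv, map_add, map_neg, ih,
      walkClass_ofPath, hc a ha]
    ring

/-- A homomorphism that is a difference of a potential on the arrows of a subquiver vanishes on the
subgroup that contracts this subquiver. -/
theorem dual_eq_zero_of_mem_contractSubgroup (γ : ParadeData b) (f : DualGroup k (FundGroup I b))
    (c : V → k) {H : WideSubquiver V}
    (hc : ∀ {x y : V} (a : x ⟶ y), a ∈ H x y → f (Additive.ofMul (cl I γ a.toPath)) = c y - c x)
    {g : FundGroup I b} (hg : g ∈ contractSubgroup I H b) : f (Additive.ofMul g) = 0 := by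
  induction hg using Subgroup.closure_induction with
  | mem g hg =>
    obtain ⟨x, y, u, u', v, rfl⟩ := hg
    -- Now the generator splits into classes of its non-closed pieces. The unknown value on `v`
    -- cancels against that on `v⁻¹`, and `u`, `u'` both contribute `c y - c x`.
    rw [← dual_walkClass_closed γ]
    simp only [walkClass_comp, walkClass_inv, ofMul_mul, ofMul_inv, map_add, map_neg,
      dual_walkClass_ofSub γ f c hc]
    ring
  | one => exact map_zero f
  | mul g h _ _ hg hh => rw [ofMul_mul, map_add, hg, hh, add_zero]
  | inv g _ hg => rw [ofMul_inv, map_neg, hg, neg_zero]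

/-- A homomorphism that is a difference of a potential on all arrows is zero. -/
theorem dual_eq_zero (γ : ParadeData b) (f : DualGroup k (FundGroup I b)) (c : V → k)
    (hc : ∀ {x y : V} (a : x ⟶ y), f (Additive.ofMul (cl I γ a.toPath)) = c y - c x) : f = 0 := by
  -- The induction needs walks with a free end point; the closed ones then get the value `c b - c
  -- b`.
  have key : ∀ {y : V} (w : Walk b y), f (Additive.ofMul (walkClass I γ w)) = c y - c b := by
    intro y w
    induction w using Walk.induction with
    | h0 => rw [walkClass_nil, ofMul_one, map_zero, sub_self]
    | hpos p a ih =>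
      rw [walkClass_comp, ofMul_mul, map_add, ih, walkClass_ofPath, hc]
      ring
    | hneg p a ih =>
      rw [walkClass_comp, walkClass_inv, ofMul_mul, ofMul_inv, map_add, map_neg, ih,
        walkClass_ofPath, hc]
      ring
  refine AddMonoidHom.ext fun g => ?_
  induction g using Quotient.inductionOn with
  | h w => exact (dual_walkClass_closed γ f w).symm.trans ((key w).trans (sub_self _))

end WalkClass

/-! ### Relative parade data -/

section Parade

variable {V : Type u} [Quiver.{v} V]

theorem exists_subWalk {H : WideSubquiver V} {x y : V} (h : component H x = component H y) :
    Nonempty (SubWalk H x y) :=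
  (WeaklyConnectedComponent.eq (V := H) x y).1 h

theorem nonempty_relParadeData (H : WideSubquiver V) (b : V)
    (hconn : ∀ x y : V, Nonempty (Walk x y)) : Nonempty (RelParadeData H b) := by
  have h : ∀ c : WeaklyConnectedComponent H, ∃ x : V, component H x = c := fun c =>
    Quotient.inductionOn c fun x => ⟨x, rfl⟩
  choose root hroot using h
  exact ⟨⟨root, hroot, fun c => (hconn b (root c)).some,
    fun y => (exists_subWalk (hroot _)).some⟩⟩

/-- The end points of `w` lie in one component, so their parade walks share the part `toRoot`, which
plays the role of `v` in a generator of `N_B`. The parallel walks are `fromRoot x` followed by `w`,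
and `fromRoot y`. -/
theorem walkClass_parade_mem {k : Type*} [Field k] [Fintype V] (I : Ideal (PathAlgebra k V))
    {H : WideSubquiver V} {b : V} (γ : RelParadeData H b) {x y : V} (w : SubWalk H x y) :
    walkClass I γ.parade (Walk.ofSub w) ∈ contractSubgroup I H b := by
  have hxy : component H x = component H y :=
    (WeaklyConnectedComponent.eq (V := H) x y).2 ⟨w⟩
  -- The component of `y` and the walk from its root are generalized, so that this component can be
  -- replaced by the propositionally equal component of `x`.
  have key : ∀ (c : WeaklyConnectedComponent H) (r : SubWalk H (γ.root c) y),
      c = component H x →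
      FundGroup.mk I (((γ.parade x).comp (Walk.ofSub w)).comp
        ((γ.toRoot c).comp (Walk.ofSub r)).inv) ∈ contractSubgroup I H b := by
    rintro c r rfl
    refine Subgroup.subset_closure ⟨_, _, @Walk.comp H _ _ _ _ (γ.fromRoot x) w, r,
      γ.toRoot _, congrArg (FundGroup.mk I) ?_⟩
    rw [Walk.ofSub_comp]
    simp only [RelParadeData.parade, Walk.inv_comp, Walk.comp_assoc]
  exact key _ (γ.fromRoot y) hxy.symm

end Parade

/-! ### Derivations -/

section Derivations

variable {k : Type*} [Field k] {A : Type*} [Ring A] [Algebra k A]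

theorem mem_Inn {D : A →ₗ[k] A} : D ∈ Inn k A ↔ ∃ a : A, ∀ x, D x = a * x - x * a := by
  constructor
  · rintro ⟨a, rfl⟩
    exact ⟨a, fun x => rfl⟩
  · rintro ⟨a, h⟩
    exact ⟨a, LinearMap.ext fun x => (h x).symm⟩

/-- Linearity over `B` gives `D c = c * D 1 = 0`; the converse is the Leibniz rule. -/
theorem mem_DerRel_iff {B : Subalgebra k A} {D : A →ₗ[k] A} :
    D ∈ DerRel B ↔ D ∈ Der k A ∧ ∀ c ∈ B, D c = 0 := by
  refine ⟨fun h => ⟨h.1, fun c hc => ?_⟩, fun h => ⟨h.1, fun c hc x => ⟨?_, ?_⟩⟩⟩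
  · have h1 : D 1 = 0 := by simpa using h.1 1 1
    have h2 := (h.2 c hc 1).1
    rwa [mul_one, h1, mul_zero] at h2
  · rw [h.1 c x, h.2 c hc, zero_mul, add_zero]
  · rw [h.1 x c, h.2 c hc, mul_zero, zero_add]

/-- `InnRel B` contains every inner derivation that is `B`-bilinear, whatever element induces it, so
nothing in `DerRel B` becomes inner only in `A`. -/
theorem hhInclusion_injective (B : Subalgebra k A) : Function.Injective (hhInclusion B) := by
  rw [← LinearMap.ker_eq_bot, LinearMap.ker_eq_bot']
  intro D hD
  induction D using Submodule.Quotient.induction_on with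
  | H D =>
  have h : (D : A →ₗ[k] A) ∈ Inn k A :=
    (Submodule.Quotient.mk_eq_zero ((Inn k A).submoduleOf (Der k A))).1 hD
  exact (Submodule.Quotient.mk_eq_zero _).2 ⟨h, D.2.2⟩

theorem dualInclusion_injective {G : Type*} [Group G] (N : Subgroup G) [N.Normal] :
    Function.Injective (dualInclusion k N) := by
  intro f g h
  refine AddMonoidHom.ext fun x => ?_
  induction x using QuotientGroup.induction_on with
  | H x => exact DFunLike.congr_fun h (Additive.ofMul x)

theorem mem_range_dualInclusion {G : Type*} [Group G] {N : Subgroup G} [N.Normal]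
    {f : DualGroup k G} (h : ∀ g ∈ N, f (Additive.ofMul g) = 0) :
    f ∈ LinearMap.range (dualInclusion k N) := by
  refine ⟨MonoidHom.toAdditiveLeft (QuotientGroup.lift N (AddMonoidHom.toMultiplicativeRight f)
    fun g hg => congrArg Multiplicative.ofAdd (h g hg)), ?_⟩
  exact AddMonoidHom.ext fun x => rfl

/-- A commutative square whose vertical maps are injective is a pullback square if every element
of `Y` with an image in `X` comes from `W`. -/
theorem isPullbackSquare_of_injective {W X Y Z : Type*} [AddCommGroup W] [Module k W]
    [AddCommGroup X] [Module k X] [AddCommGroup Y] [Module k Y] [AddCommGroup Z] [Module k Z]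
    {i : W →ₗ[k] Y} {h : W →ₗ[k] X} {g : Y →ₗ[k] Z} {j : X →ₗ[k] Z}
    (hi : Function.Injective i) (hj : Function.Injective j) (hcomm : g ∘ₗ i = j ∘ₗ h)
    (hlift : ∀ y x, g y = j x → y ∈ LinearMap.range i) : IsPullbackSquare i h g j := by
  refine ⟨hcomm, fun U _ _ α β hαβ => ?_⟩
  have hα : ∀ u, α u ∈ LinearMap.range i := fun u =>
    hlift (α u) (β u) (LinearMap.congr_fun hαβ u)
  have hφ : i ∘ₗ ((LinearEquiv.ofInjective i hi).symm.toLinearMap ∘ₗ α.codRestrict _ hα) = α :=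
    LinearMap.ext fun u =>
      congrArg Subtype.val ((LinearEquiv.ofInjective i hi).apply_symm_apply ⟨α u, hα u⟩)
  refine ⟨_, ⟨hφ, ?_⟩, fun ψ hψ => ?_⟩
  -- Since `j` is injective, it suffices that `j h φ = g i φ = g α = j β`.
  · refine LinearMap.ext fun u => hj ?_
    have h1 := LinearMap.congr_fun hcomm
      (((LinearEquiv.ofInjective i hi).symm.toLinearMap ∘ₗ α.codRestrict _ hα) u)
    have h2 := LinearMap.congr_fun hφ u
    have h3 := LinearMap.congr_fun hαβ u
    simp only [LinearMap.comp_apply] at h1 h2 h3 ⊢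
    rw [← h1, h2, h3]
  · refine LinearMap.ext fun u => hi ?_
    exact (LinearMap.congr_fun hψ.1 u).trans (LinearMap.congr_fun hφ u).symm

end Derivations

/-! ### Diagonal derivations modulo inner derivations -/

section DiagonalDerivations

variable {k : Type*} [Field k] {A : Type*} [Ring A] [Algebra k A]
  {V : Type u} [Quiver.{v} V] [Fintype V]

theorem map_vertex_mul_map_ofPath (ν : Presentation k A V) {x y : V} (p : Path x y) :
    ν.map (PathAlgebra.vertex k y) * ν.map (PathAlgebra.ofPath k p) =
      ν.map (PathAlgebra.ofPath k p) := by
  rw [← map_mul, PathAlgebra.vertex, PathAlgebra.ofPath_mul_ofPath, Path.comp_nil]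

theorem map_ofPath_mul_map_vertex (ν : Presentation k A V) {x y : V} (p : Path x y) :
    ν.map (PathAlgebra.ofPath k p) * ν.map (PathAlgebra.vertex k x) =
      ν.map (PathAlgebra.ofPath k p) := by
  rw [← map_mul, PathAlgebra.vertex, PathAlgebra.ofPath_mul_ofPath, Path.nil_comp]

theorem map_vertex_mul_map_ofPath_of_ne (ν : Presentation k A V) {x y z : V} (p : Path x y)
    (h : y ≠ z) : ν.map (PathAlgebra.vertex k z) * ν.map (PathAlgebra.ofPath k p) = 0 := by
  rw [← map_mul, PathAlgebra.vertex, PathAlgebra.ofPath_mul_ofPath_of_ne _ _ h, map_zero]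

theorem map_ofPath_mul_map_vertex_of_ne (ν : Presentation k A V) {x y z : V} (p : Path x y)
    (h : z ≠ x) : ν.map (PathAlgebra.ofPath k p) * ν.map (PathAlgebra.vertex k z) = 0 := by
  rw [← map_mul, PathAlgebra.vertex, PathAlgebra.ofPath_mul_ofPath_of_ne _ _ h, map_zero]

/-- The commutator of a linear combination of the vertices with a path. -/
theorem sum_smul_vertex_commutator (ν : Presentation k A V) (c : V → k) {x y : V} (p : Path x y) :
    (∑ z, c z • ν.map (PathAlgebra.vertex k z)) * ν.map (PathAlgebra.ofPath k p) -
      ν.map (PathAlgebra.ofPath k p) * (∑ z, c z • ν.map (PathAlgebra.vertex k z)) =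
      (c y - c x) • ν.map (PathAlgebra.ofPath k p) := by
  rw [Finset.sum_mul, Finset.mul_sum, Finset.sum_eq_single y, Finset.sum_eq_single x,
    smul_mul_assoc, mul_smul_comm, map_vertex_mul_map_ofPath, map_ofPath_mul_map_vertex, sub_smul]
  · intro z _ hz
    rw [mul_smul_comm, map_ofPath_mul_map_vertex_of_ne ν p hz, smul_zero]
  · simp
  · intro z _ hz
    rw [smul_mul_assoc, map_vertex_mul_map_ofPath_of_ne ν p hz.symm, smul_zero]
  · simp

/-- Two linear endomorphisms of `A` that agree on paths are equal. -/
theorem Presentation.hom_ext (ν : Presentation k A V) {D E : A →ₗ[k] A}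
    (h : ∀ {x y : V} (p : Path x y),
      D (ν.map (PathAlgebra.ofPath k p)) = E (ν.map (PathAlgebra.ofPath k p))) : D = E := by
  have h' : D ∘ₗ ν.map.toLinearMap = E ∘ₗ ν.map.toLinearMap := PathAlgebra.hom_ext h
  refine LinearMap.ext fun x => ?_
  obtain ⟨r, rfl⟩ := ν.surjective x
  exact LinearMap.congr_fun h' r

/-- With `d x = [γ'_x⁻¹ γ_x]`, the two classes of a path from `x` to `y` satisfy `d y * cl_γ = cl_γ'
* d x`. After applying `f`, the eigenvalues differ by `f (d x) - f (d y)`, the difference of the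
potential `-f ∘ d`, which is realized by a commutator with vertices. -/
theorem thetaDer_sub_mem_Inn (ν : Presentation k A V) {b : V} (γ γ' : ParadeData b)
    (f : DualGroup k (FundGroup ν.ideal b)) :
    (thetaDer ν γ f - thetaDer ν γ' f : A →ₗ[k] A) ∈ Inn k A := by
  set d : V → FundGroup ν.ideal b := fun x => FundGroup.mk ν.ideal ((γ x).comp (γ' x).inv) with hd
  have hcl : ∀ {x y : V} (p : Path x y), d y * cl ν.ideal γ p = cl ν.ideal γ' p * d x := by
    intro x y p
    refine FundGroup.mk_eq ?_
    have h1 := Homotopic.congr ((γ x).comp (Walk.ofPath p)) (γ' y).inv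
      (Homotopic.inv_comp (I := ν.ideal) (γ y))
    have h2 := Homotopic.congr (γ x) ((Walk.ofPath p).comp (γ' y).inv)
      (Homotopic.inv_comp (I := ν.ideal) (γ' x))
    rw [Walk.comp_nil] at h1 h2
    simp only [Walk.comp_assoc] at h1 h2 ⊢
    exact h1.trans h2.symm
  refine ⟨∑ z, (-f (Additive.ofMul (d z))) • ν.map (PathAlgebra.vertex k z),
    ν.hom_ext fun {x y} p => ?_⟩
  refine (sum_smul_vertex_commutator ν _ p).trans ?_
  have h := congrArg (fun g => f (Additive.ofMul g)) (hcl p)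
  simp only [ofMul_mul, map_add] at h
  refine Eq.trans ?_ (congrArg₂ (· - ·) (thetaEnd_ofPath ν γ f p)
    (thetaEnd_ofPath ν γ' f p)).symm
  rw [← sub_smul]
  congr 1
  linear_combination -h

theorem theta_eq_theta (ν : Presentation k A V) {b : V} (γ γ' : ParadeData b) :
    theta ν γ = theta ν γ' :=
  LinearMap.ext fun f => (Submodule.Quotient.eq _).2 (thetaDer_sub_mem_Inn ν γ γ' f)

/-- Trivial paths have trivial class. This is what makes an element `s` commute with the vertices
when its commutators with them compute the derivation. -/
theorem thetaEnd_vertex (ν : Presentation k A V) {b : V} (γ : ParadeData b)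
    (f : DualGroup k (FundGroup ν.ideal b)) (x : V) :
    thetaEnd ν γ f (ν.map (PathAlgebra.vertex k x)) = 0 := by
  have h : cl ν.ideal γ (Path.nil : Path x x) = 1 := walkClass_nil γ x
  rw [PathAlgebra.vertex, thetaEnd_ofPath, h, ofMul_one, map_zero, zero_smul]

/-- If the eigenvalue of a diagonal derivation on a set of arrows can be computed by the commutator
with an element that commutes with the vertices, then it is a difference of a potential on these
arrows. -/
theorem exists_potential [IsAlgClosed k] [FiniteDimensional k A] (ν : Presentation k A V)
    (hprim : ∀ x : V, IsPrimitiveIdempotent (ν.map (PathAlgebra.vertex k x)))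
    (harrow : ∀ (x y : V) (a : x ⟶ y), ν.map (PathAlgebra.arrow k a) ≠ 0) (s : A)
    (hs : ∀ x, s * ν.map (PathAlgebra.vertex k x) = ν.map (PathAlgebra.vertex k x) * s) :
    ∃ c : V → k, ∀ {x y : V} (a : x ⟶ y) (l : k),
      l • ν.map (PathAlgebra.arrow k a) =
        s * ν.map (PathAlgebra.arrow k a) - ν.map (PathAlgebra.arrow k a) * s →
      l = c y - c x := by
  -- Commuting with the vertex puts `s e_x` into the corner `e_x A e_x`; the potential at `x` is its
  -- eigenvalue there.
  have hn : ∀ x, ∃ c : k, IsNilpotent (s * ν.map (PathAlgebra.vertex k x) -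
      c • ν.map (PathAlgebra.vertex k x)) := fun x =>
    (hprim x).exists_isNilpotent_sub_smul
      (by rw [hs, ← mul_assoc, (hprim x).1.eq]) (by rw [mul_assoc, (hprim x).1.eq])
  choose c hc using hn
  refine ⟨c, fun {x y} a l h => ?_⟩
  have h1 : ν.map (PathAlgebra.vertex k y) * ν.map (PathAlgebra.arrow k a) =
    ν.map (PathAlgebra.arrow k a) := map_vertex_mul_map_ofPath ν a.toPath
  have h2 : ν.map (PathAlgebra.arrow k a) * ν.map (PathAlgebra.vertex k x) =
    ν.map (PathAlgebra.arrow k a) := map_ofPath_mul_map_vertex ν a.toPath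
  -- The nilpotent parts `m` at `y` and `n` at `x` satisfy `m α - α n = (l - (c y - c x)) α`, and
  -- `α` is non-zero.
  have h3 := eq_zero_of_mul_sub_mul_eq_smul (hc y) (hc x) (harrow x y a)
    (c := l - (c y - c x)) (by
      rw [sub_mul, mul_sub, smul_mul_assoc, mul_smul_comm, h1, h2, mul_assoc, h1, hs x,
        ← mul_assoc, h2, sub_smul, h, sub_smul]
      abel)
  exact sub_eq_zero.1 h3

/-- If a diagonal derivation is inner, then its homomorphism is zero. -/
theorem theta_injective [IsAlgClosed k] [FiniteDimensional k A] (ν : Presentation k A V)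
    (hprim : ∀ x : V, IsPrimitiveIdempotent (ν.map (PathAlgebra.vertex k x)))
    (harrow : ∀ (x y : V) (a : x ⟶ y), ν.map (PathAlgebra.arrow k a) ≠ 0)
    {b : V} (γ : ParadeData b) : Function.Injective (theta ν γ) := by
  rw [← LinearMap.ker_eq_bot, LinearMap.ker_eq_bot']
  intro f hf
  have h : thetaEnd ν γ f ∈ Inn k A :=
    (Submodule.Quotient.mk_eq_zero ((Inn k A).submoduleOf (Der k A))).1 hf
  obtain ⟨s, hs⟩ := mem_Inn.1 h
  obtain ⟨c, hc⟩ := exists_potential ν hprim harrow s fun x => by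
    rw [← sub_eq_zero, ← hs, thetaEnd_vertex]
  exact dual_eq_zero γ f c fun a => hc a _ ((thetaEnd_ofPath ν γ f a.toPath).symm.trans (hs _))

/-! ### Diagonal derivations relative to the subalgebra -/

variable {B : Subalgebra k A} {QB : WideSubquiver V}

theorem RelPresentation.map_ofPath (ν : RelPresentation B QB) {x y : QB} (p : Path x y) :
    ν.presA.map (PathAlgebra.ofPath k ((subInclusion QB).mapPath p)) =
      ν.presB.map (PathAlgebra.ofPath k p) := by
  rw [← ν.comm]
  exact congrArg ν.presA.map (PathAlgebra.lin_ofPath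
    (fun p : TotalPath QB => PathAlgebra.ofPath k ((subInclusion QB).mapPath p.path)) p).symm

theorem RelPresentation.map_arrow_mem (ν : RelPresentation B QB) {x y : V} (a : x ⟶ y)
    (ha : a ∈ QB x y) : ν.presA.map (PathAlgebra.arrow k a) ∈ B := by
  have h := ν.map_ofPath (Quiver.Hom.toPath (V := QB) (a := x) (b := y) ⟨a, ha⟩)
  have h' : ν.presA.map (PathAlgebra.arrow k a) = _ := h
  rw [h']
  exact Subtype.prop _

theorem RelPresentation.map_vertex_mem (ν : RelPresentation B QB) (x : V) :
    ν.presA.map (PathAlgebra.vertex k x) ∈ B := by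
  have h : ν.presA.map (PathAlgebra.vertex k x) = _ := ν.map_ofPath (Path.nil : @Path QB _ x x)
  rw [h]
  exact Subtype.prop _

/-- Diagonal derivations of homomorphisms that vanish on the contracted subgroup are bimodule
homomorphisms, if they are computed with a relative parade data. -/
theorem thetaDer_mem_DerRel (ν : RelPresentation B QB) {b : V} (γ : RelParadeData QB b)
    (f : DualGroup k (FundGroup ν.presA.ideal b ⧸ contractSubgroup ν.presA.ideal QB b)) :
    (thetaDer ν.presA γ.parade (dualInclusion k _ f) : A →ₗ[k] A) ∈ DerRel B := by
  refine mem_DerRel_iff.2 ⟨Subtype.prop _, fun c hc => ?_⟩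
  change thetaEnd ν.presA γ.parade (dualInclusion k _ f) c = 0
  obtain ⟨r, hr⟩ := ν.presB.surjective ⟨c, hc⟩
  obtain rfl : (ν.presB.map r : A) = c := congrArg Subtype.val hr
  clear hr hc
  induction r using PathAlgebra.induction with
  | h0 => simp
  | hadd r s hr hs => rw [map_add, B.coe_add, map_add, hr, hs, add_zero]
  | @hpath c x y p =>
    -- Images of paths of `Q_B` span `B`, so it suffices that the class of such a path dies in the
    -- quotient by `N_B`.
    have hmem : cl ν.presA.ideal γ.parade ((subInclusion QB).mapPath p) ∈
        contractSubgroup ν.presA.ideal QB b := by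
      have h := walkClass_parade_mem ν.presA.ideal γ (Walk.ofPath (V := QB) p)
      have e : Walk.ofSub (H := QB) (Walk.ofPath (V := QB) p) =
          Walk.ofPath ((subInclusion QB).mapPath p) := by
        induction p with
        | nil => rfl
        | cons p a ih =>
          exact congrArg (fun w => Walk.comp w (Walk.ofPath (Quiver.Hom.toPath (V := V) a.1)))
            (ih (walkClass_parade_mem ν.presA.ideal γ _))
      rwa [e] at h
    have h0 : dualInclusion k _ f
        (Additive.ofMul (cl ν.presA.ideal γ.parade ((subInclusion QB).mapPath p))) = 0 := by
      refine Eq.trans ?_ (map_zero f)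
      exact congrArg f ((QuotientGroup.eq_one_iff _).2 hmem)
    rw [map_smul, B.coe_smul, map_smul, ← ν.map_ofPath, thetaEnd_ofPath, h0, zero_smul, smul_zero]

/-- The map `θ_ν^{(A|B)} : Hom(π₁(Q_A, I_A)/N_B, k) → HH¹(A|B)`, computed with the relative parade
data `γ`. -/
noncomputable def thetaRel (ν : RelPresentation B QB) {b : V} (γ : RelParadeData QB b) :
    DualGroup k (FundGroup ν.presA.ideal b ⧸ contractSubgroup ν.presA.ideal QB b) →ₗ[k]
      HH1Rel B :=
  ((InnRel B).submoduleOf (DerRel B)).mkQ ∘ₗ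
    LinearMap.codRestrict (DerRel B)
      ((Der k A).subtype ∘ₗ thetaDer ν.presA γ.parade ∘ₗ dualInclusion k _)
      (thetaDer_mem_DerRel ν γ)

theorem theta_comp_dualInclusion (ν : RelPresentation B QB) {b : V} (γ : RelParadeData QB b) :
    theta ν.presA γ.parade ∘ₗ dualInclusion k (contractSubgroup ν.presA.ideal QB b) =
      hhInclusion B ∘ₗ thetaRel ν γ := rfl

/-- If a diagonal derivation is cohomologous to a bimodule derivation, then its homomorphism
vanishes on the contracted subgroup. -/
theorem mem_range_dualInclusion_of_theta_eq [IsAlgClosed k] [FiniteDimensional k A]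
    (ν : RelPresentation B QB)
    (hprim : ∀ x : V, IsPrimitiveIdempotent (ν.presA.map (PathAlgebra.vertex k x)))
    (harrow : ∀ (x y : V) (a : x ⟶ y), ν.presA.map (PathAlgebra.arrow k a) ≠ 0)
    {b : V} (γ : ParadeData b) (f : DualGroup k (FundGroup ν.presA.ideal b)) (D : HH1Rel B)
    (h : theta ν.presA γ f = hhInclusion B D) :
    f ∈ LinearMap.range (dualInclusion k (contractSubgroup ν.presA.ideal QB b)) := by
  induction D using Submodule.Quotient.induction_on with
  | H D =>
  have h' : thetaEnd ν.presA γ f - (D : A →ₗ[k] A) ∈ Inn k A :=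
    (Submodule.Quotient.eq ((Inn k A).submoduleOf (Der k A))).1 h
  obtain ⟨s, hs⟩ := mem_Inn.1 h'
  -- `D` vanishes on `B`, so on `B` the diagonal derivation is the commutator with `s`. This covers
  -- all vertices but only the arrows of `Q_B`.
  have hsB : ∀ c ∈ B, thetaEnd ν.presA γ f c = s * c - c * s := fun c hc => by
    rw [← hs, LinearMap.sub_apply, (mem_DerRel_iff.1 D.2).2 c hc, sub_zero]
  obtain ⟨c, hc⟩ := exists_potential ν.presA hprim harrow s fun x => by
    rw [← sub_eq_zero, ← hsB _ (ν.map_vertex_mem x), thetaEnd_vertex]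
  exact mem_range_dualInclusion fun g hg => dual_eq_zero_of_mem_contractSubgroup γ f c
    (fun a ha => hc a _ ((thetaEnd_ofPath ν.presA γ f a.toPath).symm.trans
      (hsB _ (ν.map_arrow_mem a ha)))) hg

end DiagonalDerivations

end RelHH

/-! ### The pullback square -/

theorem theoremC {k : Type u₀} [Field k] [IsAlgClosed k] {A : Type u₁} [Ring A] [Algebra k A]
    [FiniteDimensional k A] {V : Type u₂} [Quiver.{u₃} V] [Fintype V]
    (B : Subalgebra k A) (QB : WideSubquiver V) (ν : RelPresentation B QB)
    (hconn : ∀ x y : V, Nonempty (Walk x y))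
    (hprim : ∀ x : V, IsPrimitiveIdempotent (ν.presA.map (PathAlgebra.vertex k x)))
    (harrow : ∀ (x y : V) (a : x ⟶ y), ν.presA.map (PathAlgebra.arrow k a) ≠ 0)
    (b : V) :
    Nonempty (RelParadeData QB b) ∧
    (∀ γ γ' : ParadeData b, theta ν.presA γ = theta ν.presA γ') ∧
    ∃ θAB : DualGroup k (FundGroup ν.presA.ideal b ⧸ contractSubgroup ν.presA.ideal QB b) →ₗ[k]
        HH1Rel B,
      (∀ (γ : RelParadeData QB b)
        (f : DualGroup k (FundGroup ν.presA.ideal b ⧸ contractSubgroup ν.presA.ideal QB b)),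
        ∃ h : (thetaDer ν.presA γ.parade (dualInclusion k _ f) : A →ₗ[k] A) ∈ DerRel B,
          θAB f = Submodule.Quotient.mk ⟨_, h⟩) ∧
      Function.Injective θAB ∧
      ∀ γ : ParadeData b,
        IsPullbackSquare.{t} (dualInclusion k (contractSubgroup ν.presA.ideal QB b)) θAB
          (theta ν.presA γ) (hhInclusion B) := by
  obtain ⟨γ₀⟩ := nonempty_relParadeData QB b hconn
  refine ⟨⟨γ₀⟩, theta_eq_theta ν.presA, thetaRel ν γ₀, fun γ f => ?_, ?_, fun γ => ?_⟩
  -- The map was built from the single choice `γ₀`. Classes for another relative parade data are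
  -- compared in `HH¹(A)`, where the choice does not matter.
  · refine ⟨thetaDer_mem_DerRel ν γ f, hhInclusion_injective B ?_⟩
    have h := LinearMap.congr_fun (theta_eq_theta ν.presA γ₀.parade γ.parade)
      (dualInclusion k _ f)
    exact h
  -- By commutativity this composite is `θ_ν ∘ ι`, a composite of injective maps.
  · have h : Function.Injective (hhInclusion B ∘ₗ thetaRel ν γ₀) := by
      rw [← theta_comp_dualInclusion]
      exact (theta_injective ν.presA hprim harrow γ₀.parade).comp (dualInclusion_injective _)
    exact Function.Injective.of_comp (f := hhInclusion B) h
  · refine isPullbackSquare_of_injective (dualInclusion_injective _) (hhInclusion_injective B) ?_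
      (mem_range_dualInclusion_of_theta_eq ν hprim harrow γ)
    rw [theta_eq_theta ν.presA γ γ₀.parade, theta_comp_dualInclusion]
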